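/- Let $k$ be a field and let $\mathcal C$ be a skeletally small, Hom-finite, Krull–Schmidt, $k$-linear triangulated category with suspension functor $\Sigma$ and with Serre duality, i.e. an autoequivalence $\nu$ of $\mathcal C$ with $k$-linear isomorphisms $\operatorname{Hom}_{\mathcal C}(X,Y)\cong \operatorname{Hom}_k(\operatorname{Hom}_{\mathcal C}(Y,\nu X),k)$ natural in $X$ and $Y$. Let $T$ be a rigid object of $\mathcal C$, i.e. $\operatorname{Ext}^1(T,T)=\operatorname{Hom}_{\mathcal C}(T,\Sigma T)=0$. Let $\mathcal X_T=(\Sigma T)^\perp$ be the full subcategory of those objects $C$ with $\operatorname{Ext}^1(X,C)=\operatorname{Hom}_{\mathcal C}(X,\Sigma C)=0$ for every $X$ in the additive closure $\operatorname{add}\Sigma T$; equivalently, $\operatorname{Hom}_{\mathcal C}(T,C)=0$. Let $\mathcal C/\mathcal X_T$ be the factor category, which has the same objects as $\mathcal C$ and whose morphisms are the morphisms of $\mathcal C$ modulo those factoring through an object of $\mathcal X_T$. Write $\underline f$ for the image in $\mathcal C/\mathcal X_T$ of a morphism $f$ of $\mathcal C$; thus $\underline f=0$ if and only if $f$ factors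 through an object of $\mathcal X_T$. A morphism is called regular if it is both a monomorphism and an epimorphism. Let $\Sigma^{-1}Z\xrightarrow{h}X\xrightarrow{f}Y\xrightarrow{g}Z$ be a distinguished triangle in $\mathcal C$. Then: (a) $\underline f$ is a monomorphism in $\mathcal C/\mathcal X_T$ if and only if $\underline h=0$; (b) $\underline f$ is an epimorphism in $\mathcal C/\mathcal X_T$ if and only if $\underline g=0$; (c) $\underline f$ is regular if and only if $\underline g=0=\underline h$. -/

import Mathlib

open CategoryTheory CategoryTheory.Limits CategoryTheory.Pretriangulated

universe w v u

namespace RigidQuotient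

/-- A category is Krull-Schmidt if every object is a finite direct sum of objects with local
endomorphism rings (the empty direct sum being the zero object). -/
def IsKrullSchmidt (C : Type u) [Category.{v} C] [Preadditive C] [HasFiniteBiproducts C] : Prop :=
  ∀ X : C, ∃ (n : ℕ) (F : Fin n → C), (∀ i, IsLocalRing (End (F i))) ∧ Nonempty (X ≅ ⨁ F)

/-- A `k`-linear category is Hom-finite if all its Hom-spaces are finite dimensional. -/
def IsHomFinite (k : Type w) [Field k] (C : Type u) [Category.{v} C] [Preadditive C]
    [Linear k C] : Prop :=
  ∀ X Y : C, Module.Finite k (X ⟶ Y)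

/-- A Serre duality: an autoequivalence `ν` with isomorphisms `Hom(X, Y) ≃ D Hom(Y, ν X)`,
natural in `X` and `Y`, where `D = Hom_k(-, k)`. -/
structure SerreDuality (k : Type w) [Field k] (C : Type u) [Category.{v} C] [Preadditive C]
    [Linear k C] where
  /-- the Serre functor -/
  ν : C ≌ C
  /-- the duality isomorphisms -/
  dual : ∀ X Y : C, (X ⟶ Y) ≃ₗ[k] Module.Dual k (Y ⟶ ν.functor.obj X)
  /-- naturality of the duality isomorphisms in both variables -/
  dual_natural : ∀ {X X' Y Y' : C} (a : X' ⟶ X) (b : Y ⟶ Y') (f : X ⟶ Y)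
    (φ : Y' ⟶ ν.functor.obj X'),
    dual X' Y' (a ≫ f ≫ b) φ = dual X Y f (b ≫ φ ≫ ν.functor.map a)

/-- `f` factors through an object of the full subcategory `P`. -/
def FactorsThrough {C : Type u} [Category.{v} C] (P : ObjectProperty C) {X Y : C}
    (f : X ⟶ Y) : Prop :=
  ∃ (U : C) (a : X ⟶ U) (b : U ⟶ Y), P U ∧ a ≫ b = f

/-- A morphism is regular if it is both a monomorphism and an epimorphism. -/
def IsRegularMorphism {C : Type u} [Category.{v} C] {X Y : C} (f : X ⟶ Y) : Prop :=
  Mono f ∧ Epi f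

section Triangulated

variable {C : Type u} [Category.{v} C] [Preadditive C] [HasZeroObject C] [HasShift C ℤ]
  [∀ n : ℤ, (shiftFunctor C n).Additive] [Pretriangulated C]

/-- `Ext¹(X, Y) = Hom(X, ΣY)`, where `Σ` is the suspension. -/
abbrev Ext1 (X Y : C) : Type v := X ⟶ Y⟦(1 : ℤ)⟧

/-- `T` is rigid if `Ext¹(T, T) = 0`. -/
def IsRigid (T : C) : Prop := ∀ e : Ext1 T T, e = 0

/-- The additive closure of `X`: the direct summands of finite direct sums of copies of `X`. -/
def addClosure (X : C) : ObjectProperty C :=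
  fun Y => ∃ n : ℕ, Nonempty (Retract Y (⨁ fun _ : Fin n => X))

/-- The right perpendicular subcategory, consisting of those `Y` with `Ext¹(X, Y) = 0` for all
`X` in `P`. -/
def rightPerp (P : ObjectProperty C) : ObjectProperty C :=
  fun Y => ∀ X, P X → ∀ e : Ext1 X Y, e = 0

/-- The subcategory `X_T = (ΣT)^⊥ = (add ΣT)^⊥`. -/
def XT (T : C) : ObjectProperty C := rightPerp (addClosure (T⟦(1 : ℤ)⟧))

/-- An object is in `X_T` if and only if `Hom(T, Y) = 0`. -/
theorem XT_iff (T Y : C) : XT T Y ↔ ∀ g : T ⟶ Y, g = 0 := by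
  constructor
  · intro h g
    have hT : addClosure (T⟦(1 : ℤ)⟧) (T⟦(1 : ℤ)⟧) :=
      ⟨1, ⟨{ i := biproduct.ι (fun _ : Fin 1 => T⟦(1 : ℤ)⟧) 0
             r := biproduct.π (fun _ : Fin 1 => T⟦(1 : ℤ)⟧) 0
             retract := biproduct.ι_π_self _ _ }⟩⟩
    apply (shiftFunctor C (1 : ℤ)).map_injective
    rw [Functor.map_zero]
    exact h _ hT _
  · rintro h X ⟨n, ⟨r⟩⟩ e
    have h' : r.r ≫ e = 0 := by
      refine biproduct.hom_ext' _ _ fun j => ?_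
      obtain ⟨g, hg⟩ := (shiftFunctor C (1 : ℤ)).map_surjective
        (biproduct.ι (fun _ : Fin n => T⟦(1 : ℤ)⟧) j ≫ r.r ≫ e)
      rw [← hg, h g, Functor.map_zero, comp_zero]
    calc e = r.i ≫ r.r ≫ e := by rw [r.retract_assoc]
      _ = 0 := by rw [h', comp_zero]

/-- Morphisms `f, g` are identified in `C/X_T` when `f - g` factors through `X_T`. -/
def factorRel (T : C) : HomRel C := fun _ _ f g => FactorsThrough (XT T) (f - g)

open scoped ZeroObject in
theorem factorsThrough_zero (T : C) (X Y : C) : FactorsThrough (XT T) (0 : X ⟶ Y) :=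
  ⟨(0 : C), 0, 0, (XT_iff T (0 : C)).2 fun _ => (isZero_zero C).eq_of_tgt _ _, by simp⟩

theorem factorsThrough_add (T : C) {X Y : C} {f g : X ⟶ Y} (hf : FactorsThrough (XT T) f)
    (hg : FactorsThrough (XT T) g) : FactorsThrough (XT T) (f + g) := by
  obtain ⟨U, a, b, hU, rfl⟩ := hf
  obtain ⟨V, c, d, hV, rfl⟩ := hg
  refine ⟨U ⊞ V, biprod.lift a c, biprod.desc b d, ?_, by simp⟩
  rw [XT_iff] at hU hV ⊢
  intro t
  apply biprod.hom_ext
  · rw [hU (t ≫ biprod.fst), zero_comp]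
  · rw [hV (t ≫ biprod.snd), zero_comp]

theorem factorsThrough_neg (T : C) {X Y : C} {f : X ⟶ Y} (hf : FactorsThrough (XT T) f) :
    FactorsThrough (XT T) (-f) := by
  obtain ⟨U, a, b, hU, rfl⟩ := hf
  exact ⟨U, -a, b, hU, by simp⟩

instance factorRel_congruence (T : C) : Congruence (factorRel T) where
  equivalence :=
    { refl := fun f => by
        simpa [factorRel] using factorsThrough_zero T _ _
      symm := fun {f g} h => by
        simpa [factorRel] using factorsThrough_neg T h
      trans := fun {f g h} h₁ h₂ => by
        simpa [factorRel] using factorsThrough_add T h₁ h₂ }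
  comp_left := by
    rintro X Y Z f g g' ⟨U, a, b, hU, h⟩
    exact ⟨U, f ≫ a, b, hU, by simp [h]⟩
  comp_right := by
    rintro X Y Z f f' g ⟨U, a, b, hU, h⟩
    exact ⟨U, a, b ≫ g, hU, by rw [← Category.assoc, h, Preadditive.sub_comp]⟩

/-- The factor category `C/X_T`: its objects are those of `C`, and its morphisms are the morphisms
of `C` modulo those factoring through `X_T`. -/
abbrev FactorCategory (T : C) : Type u := Quotient (factorRel T)

theorem factorRel_add (T : C) ⦃X Y : C⦄ (f₁ f₂ g₁ g₂ : X ⟶ Y) (hf : factorRel T f₁ f₂)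
    (hg : factorRel T g₁ g₂) : factorRel T (f₁ + g₁) (f₂ + g₂) := by
  have h := factorsThrough_add T hf hg
  rwa [← add_sub_add_comm] at h

instance factorCategoryPreadditive (T : C) : Preadditive (FactorCategory T) :=
  Quotient.preadditive (factorRel T) (factorRel_add T)

/-- The canonical functor from `C` to `C/X_T`. -/
abbrev toFactor (T : C) : C ⥤ FactorCategory T := Quotient.functor (factorRel T)

instance toFactor_additive (T : C) : (toFactor T).Additive :=
  Quotient.functor_additive (factorRel T) (factorRel_add T)

theorem toFactor_map_eq_zero_iff (T : C) {X Y : C} (f : X ⟶ Y) :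
    (toFactor T).map f = 0 ↔ FactorsThrough (XT T) f := by
  rw [← (toFactor T).map_zero X Y, Quotient.functor_map_eq_iff, factorRel, sub_zero]

end Triangulated

end RigidQuotient

open RigidQuotient

namespace RigidQuotient

section Factorization

variable {C : Type u} [Category.{v} C] [Preadditive C] [HasZeroObject C] [HasShift C ℤ]
  [∀ n : ℤ, (shiftFunctor C n).Additive] [Pretriangulated C]

/-! The point is that `Hom(T, -)` is faithful on the factor category (`factorsThrough_XT_iff`): the
cone of a right `add T`-approximation of `X` lies in `XT T` by rigidity, and every morphism from `X`
killed by `Hom(T, -)` factors through that cone. So injectivity or surjectivity of `Hom(T, f)` makes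
the image of `f` mono or epi, and the long exact sequence of `Hom(T, -)` derives these from the
vanishing of `h` or `g`. Conversely, `h ≫ f = 0` and `f ≫ g = 0`, so cancelling a mono or epi image
of `f` kills `h` or `g`. -/

theorem FactorsThrough.comp_eq_zero {T X Y : C} {a : X ⟶ Y} (ha : FactorsThrough (XT T) a)
    (t : T ⟶ X) : t ≫ a = 0 := by
  obtain ⟨U, b, c, hU, rfl⟩ := ha
  rw [← Category.assoc, (XT_iff T U).1 hU (t ≫ b), zero_comp]

/-- Every object has a right approximation by a finite direct sum of copies of `T`. -/
theorem exists_right_approximation {k : Type w} [Field k] [Linear k C] (hfin : IsHomFinite k C)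
    (T X : C) :
    ∃ (n : ℕ) (p : (⨁ fun _ : Fin n => T) ⟶ X), ∀ t : T ⟶ X, ∃ s, s ≫ p = t := by
  have := hfin T X
  -- One copy of `T` per basis vector; the coordinates of `t` give its lift.
  let e := Module.finBasis k (T ⟶ X)
  refine ⟨_, biproduct.desc fun i => e i, fun t =>
    ⟨biproduct.lift fun i => e.repr t i • 𝟙 T, ?_⟩⟩
  rw [biproduct.lift_desc]
  simp [e.sum_repr t]

/-- If `T` is rigid, a morphism factors through `X_T` if and only if `Hom(T, -)` kills it. -/
theorem factorsThrough_XT_iff {k : Type w} [Field k] [Linear k C] (hfin : IsHomFinite k C)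
    {T : C} (hT : IsRigid T) {X Y : C} (a : X ⟶ Y) :
    FactorsThrough (XT T) a ↔ ∀ t : T ⟶ X, t ≫ a = 0 := by
  refine ⟨fun ha => ha.comp_eq_zero, fun ha => ?_⟩
  obtain ⟨n, p, hp⟩ := exists_right_approximation hfin T X
  obtain ⟨V, q, r, hpq⟩ := distinguished_cocone_triangle p
  have hpa : p ≫ a = 0 := biproduct.hom_ext' _ _ fun i => by
    rw [comp_zero, ← Category.assoc]
    exact ha _
  obtain ⟨b, hb⟩ := Triangle.yoneda_exact₂ _ hpq a hpa
  -- Any `s : T ⟶ V` dies in the shifted sum of copies of `T`, so it comes from `X`, hence through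
  -- `p`, and `p ≫ q = 0`.
  refine ⟨V, q, b, (XT_iff T V).2 fun s => ?_, hb.symm⟩
  have hsr : s ≫ r = 0 := by
    have : ∀ e : T ⟶ (⨁ fun _ : Fin n => T)⟦(1 : ℤ)⟧, e = 0 := fun e => by
      have he : 𝟙 _ = ∑ i, (biproduct.π (fun _ : Fin n => T) i)⟦(1 : ℤ)⟧' ≫
          (biproduct.ι (fun _ : Fin n => T) i)⟦(1 : ℤ)⟧' := by
        simp_rw [← Functor.map_comp, ← Functor.map_sum, biproduct.total, CategoryTheory.Functor.map_id]
      rw [← Category.comp_id e, he, Preadditive.comp_sum]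
      refine Finset.sum_eq_zero fun i _ => ?_
      rw [← Category.assoc, hT (e ≫ _), zero_comp]
    exact this _
  obtain ⟨t, ht⟩ := Triangle.coyoneda_exact₃ _ hpq s hsr
  obtain ⟨u, hu⟩ := hp t
  have hpq0 : p ≫ q = 0 := comp_distTriang_mor_zero₁₂ _ hpq
  calc s = t ≫ q := ht
    _ = u ≫ p ≫ q := by rw [← hu]; exact Category.assoc u p q
    _ = 0 := by rw [hpq0, comp_zero]

theorem toFactor_map_eq_zero_iff_comp {k : Type w} [Field k] [Linear k C]
    (hfin : IsHomFinite k C) {T : C} (hT : IsRigid T) {X Y : C} (a : X ⟶ Y) :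
    (toFactor T).map a = 0 ↔ ∀ t : T ⟶ X, t ≫ a = 0 := by
  rw [toFactor_map_eq_zero_iff, factorsThrough_XT_iff hfin hT]

theorem mono_toFactor_map {k : Type w} [Field k] [Linear k C] (hfin : IsHomFinite k C)
    {T : C} (hT : IsRigid T) {X Y : C} (f : X ⟶ Y)
    (hf : ∀ t : T ⟶ X, t ≫ f = 0 → t = 0) : Mono ((toFactor T).map f) := by
  refine Preadditive.mono_of_cancel_zero _ fun {W} a ha => ?_
  obtain ⟨W⟩ := W
  obtain ⟨a, rfl⟩ := (toFactor T).map_surjective (X := W) a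
  rw [← Functor.map_comp, toFactor_map_eq_zero_iff_comp hfin hT] at ha
  exact (toFactor_map_eq_zero_iff_comp hfin hT a).2 fun t => hf _ (by simpa using ha t)

/-- Every `t : T ⟶ Y` lifts through `f`, so `t ≫ a` vanishes as soon as `Hom(T, -)` kills `f ≫ a`.
-/
theorem epi_toFactor_map {k : Type w} [Field k] [Linear k C] (hfin : IsHomFinite k C)
    {T : C} (hT : IsRigid T) {X Y : C} (f : X ⟶ Y)
    (hf : ∀ t : T ⟶ Y, ∃ s, t = s ≫ f) : Epi ((toFactor T).map f) := by
  refine Preadditive.epi_of_cancel_zero _ fun {W} a ha => ?_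
  obtain ⟨W⟩ := W
  obtain ⟨a, rfl⟩ := (toFactor T).map_surjective (Y := W) a
  rw [← Functor.map_comp, toFactor_map_eq_zero_iff_comp hfin hT] at ha
  refine (toFactor_map_eq_zero_iff_comp hfin hT a).2 fun t => ?_
  obtain ⟨s, rfl⟩ := hf t
  rw [Category.assoc, ha s]

/-- The criteria for monomorphisms and epimorphisms in `C/X_T`, for a triangle whose third map is
`g` followed by an isomorphism `e`. -/
theorem mono_and_epi_toFactor_map_iff {k : Type w} [Field k] [Linear k C]
    (hfin : IsHomFinite k C) {T : C} (hT : IsRigid T) {A X Y Z : C} (h : A ⟶ X) (f : X ⟶ Y)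
    (g : Y ⟶ Z) (e : Z ⟶ A⟦(1 : ℤ)⟧) [IsIso e] (hdist : Triangle.mk h f (g ≫ e) ∈ distTriang C) :
    (Mono ((toFactor T).map f) ↔ (toFactor T).map h = 0) ∧
    (Epi ((toFactor T).map f) ↔ (toFactor T).map g = 0) := by
  have hhf : h ≫ f = 0 := comp_distTriang_mor_zero₁₂ _ hdist
  have hfg : f ≫ g = 0 := by
    have hz : f ≫ g ≫ e = 0 := comp_distTriang_mor_zero₂₃ _ hdist
    rw [← cancel_mono e, Category.assoc, hz, zero_comp]
  constructor
  · refine ⟨fun _ => ?_, fun hh => mono_toFactor_map hfin hT f fun t ht => ?_⟩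
    · rw [← cancel_mono ((toFactor T).map f), ← Functor.map_comp, hhf, Functor.map_zero,
        zero_comp]
    · obtain ⟨s, hs⟩ := Triangle.coyoneda_exact₂ _ hdist t ht
      exact hs.trans ((toFactor_map_eq_zero_iff_comp hfin hT h).1 hh s)
  · refine ⟨fun _ => ?_, fun hg => epi_toFactor_map hfin hT f fun t => ?_⟩
    · rw [← cancel_epi ((toFactor T).map f), ← Functor.map_comp, hfg, Functor.map_zero,
        comp_zero]
    -- Exactness at `Y`: the lift of `t` through `f` exists once `t ≫ g ≫ e = 0`.
    · refine Triangle.coyoneda_exact₃ _ hdist t ?_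
      change t ≫ g ≫ e = 0
      rw [← Category.assoc, (toFactor_map_eq_zero_iff_comp hfin hT g).1 hg t, zero_comp]

end Factorization

end RigidQuotient

theorem lemma3p3 (k : Type w) [Field k] (C : Type u) [Category.{v} C] [EssentiallySmall.{v} C]
    [Preadditive C] [Linear k C] [HasZeroObject C] [HasShift C ℤ]
    [∀ n : ℤ, (shiftFunctor C n).Additive] [Pretriangulated C] [IsTriangulated C]
    (hfin : IsHomFinite k C) (hKS : IsKrullSchmidt C) (S : SerreDuality k C)
    (T : C) (hT : IsRigid T)
    {X Y Z : C} (h : Z⟦(-1 : ℤ)⟧ ⟶ X) (f : X ⟶ Y) (g : Y ⟶ Z)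
    -- the last map is `g` under the canonical identification `Z ≅ Σ(Σ⁻¹Z)`
    (hdist : Triangle.mk h f
        (g ≫ (shiftFunctorCompIsoId C (-1 : ℤ) 1 (by simp)).inv.app Z) ∈ distTriang C) :
    (Mono ((toFactor T).map f) ↔ (toFactor T).map h = 0) ∧
    (Epi ((toFactor T).map f) ↔ (toFactor T).map g = 0) ∧
    (IsRegularMorphism ((toFactor T).map f) ↔
      (toFactor T).map g = 0 ∧ (toFactor T).map h = 0) := by
  obtain ⟨mono_iff, epi_iff⟩ := mono_and_epi_toFactor_map_iff hfin hT h f g _ hdist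
  exact ⟨mono_iff, epi_iff, by rw [IsRegularMorphism, mono_iff, epi_iff, and_comm]⟩
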